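/- For $n \ge 32$ let $f_7 \colon \{0,1\}^n \to \{0,1,\perp\}$ be the partial Boolean function with $f_7(x) = 0$ if the Hamming weight $|x|$ is at most $7$, $f_7(x) = 1$ if $|x| = n$, and $f_7(x) = \perp$ (undefined) if $8 \le |x| \le n-1$. Let $F_7(x,y) = f_7(x \oplus y)$ for $x, y \in \{0,1\}^n$, where $\oplus$ is bitwise XOR. For a partial function $F \colon \{0,1\}^n \times \{0,1\}^n \to \{0,1,\perp\}$, let $\mathrm{D_{cc}^{\rightarrow}}(F)$ (the deterministic one-way communication complexity) be the smallest $t$ for which there are total functions $h \colon \{0,1\}^n \to \{0,1\}^t$ and $\varphi \colon \{0,1\}^t \times \{0,1\}^n \to \{0,1\}$ with $\varphi(h(x), y) = F(x,y)$ whenever $F(x,y) \ne \perp$. For a partial function $f \colon \{0,1\}^n \to \{0,1,\perp\}$, let $\mathrm{NADT^{\oplus}}(f)$ (the non-adaptive parity decision tree complexity) be the smallest $p$ for which there are $s_1, \dots, s_p \in \{0,1\}^n$ and a total function $l \colon \{0,1\}^p \to \{0,1\}$ with $l(\langle s_1, x\rangle, \dots, \langle s_p, x\rangle) = f(x)$ whenever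 $f(x) \ne \perp$, where $\langle s, x\rangle = \bigoplus_i s_i \wedge x_i$. Theorem. For every $n \ge 32$, $$\mathrm{D_{cc}^{\rightarrow}}(F_7) \le 7 \quad\text{and}\quad \mathrm{NADT^{\oplus}}(f_7) = 8.$$ -/

import Mathlib

namespace XorComm

/-- The Boolean cube `{0,1}^n`, viewed as the vector space `𝔽₂ⁿ`; addition is bitwise XOR. -/
abbrev Cube (n : ℕ) : Type := Fin n → ZMod 2

/-- A partial Boolean function `{0,1}^n → {0,1,⊥}`; the value `none` is `⊥` (undefined). -/
abbrev PartialBool (n : ℕ) : Type := Cube n → Option (ZMod 2)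

/-- The XOR function `F(x, y) = f(x ⊕ y)` of a partial Boolean function `f`. -/
def xorFun {n : ℕ} (f : PartialBool n) : Cube n → Cube n → Option (ZMod 2) :=
  fun x y => f (x + y)

/-- Alice's message map `h` and Bob's output map `φ` form a `t`-bit one-way protocol for the
partial two-party function `F`: the output is correct wherever `F` is defined. -/
def OneWayComputes {n t : ℕ} (h : Cube n → Cube t) (φ : Cube t → Cube n → ZMod 2)
    (F : Cube n → Cube n → Option (ZMod 2)) : Prop :=
  ∀ x y : Cube n, ∀ b : ZMod 2, F x y = some b → φ (h x) y = b

/-- One-way deterministic communication complexity: the least `t` such that a `t`-bit one-way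
protocol exists (one always does, see `exists_oneWay`). -/
noncomputable def oneWayCC {n : ℕ} (F : Cube n → Cube n → Option (ZMod 2)) : ℕ :=
  sInf {t : ℕ | ∃ (h : Cube n → Cube t) (φ : Cube t → Cube n → ZMod 2), OneWayComputes h φ F}

/-- The queries `s₁, …, s_p` and the output map `l` form a non-adaptive parity decision tree
for `f`: on input `x` it outputs `l(⟨s₁, x⟩, …, ⟨s_p, x⟩)`, with inner products over `𝔽₂`. -/
def ParityComputes {n p : ℕ} (s : Fin p → Cube n) (l : Cube p → ZMod 2)
    (f : PartialBool n) : Prop :=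
  ∀ x : Cube n, ∀ b : ZMod 2, f x = some b → l (fun i => s i ⬝ᵥ x) = b

/-- Non-adaptive parity decision tree complexity: the least number of queries of a protocol
for `f` (one always exists, see `exists_parity`). -/
noncomputable def nadt {n : ℕ} (f : PartialBool n) : ℕ :=
  sInf {p : ℕ | ∃ (s : Fin p → Cube n) (l : Cube p → ZMod 2), ParityComputes s l f}

/-- The partial function `f_k` on `n` bits (meant for `k < n`): `0` on inputs of Hamming weight
at most `k`, `1` on the all-ones input, undefined otherwise. -/
def thresholdFun (n k : ℕ) : PartialBool n := fun x =>
  if hammingNorm x ≤ k then some 0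
  else if hammingNorm x = n then some 1
  else none

/-- Sending the whole input is a protocol, so the set defining `oneWayCC` is nonempty. -/
theorem exists_oneWay {n : ℕ} (F : Cube n → Cube n → Option (ZMod 2)) :
    ∃ (t : ℕ) (h : Cube n → Cube t) (φ : Cube t → Cube n → ZMod 2), OneWayComputes h φ F := by
  refine ⟨n, id, fun x y => (F x y).getD 0, ?_⟩
  intro x y b hb
  simp [hb]

/-- Querying every bit is a protocol, so the set defining `nadt` is nonempty. -/
theorem exists_parity {n : ℕ} (f : PartialBool n) :
    ∃ (p : ℕ) (s : Fin p → Cube n) (l : Cube p → ZMod 2), ParityComputes s l f := by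
  refine ⟨n, fun i => Pi.single i 1, fun x => (f x).getD 0, ?_⟩
  intro x b hb
  simp [hb]

end XorComm

/-!
Bob wants to know whether `x` lies within distance `k` of `y` or equals the complement of `y`, so
it suffices for Alice to name the class of `x` in a partition of the cube into sets of diameter
less than `n - k`. On `2 ^ m` chosen coordinates `x` is a function on `𝔽₂ᵐ`. By Parseval some Walsh
coefficient of it has absolute value at least `2 ^ (m / 2)`, which puts it close to an affine
function; if moreover it has even weight, then all its Walsh coefficients are divisible by `4`,
which improves the bound to the next multiple of `4`. The `m + 2` bits sent are the parity of the
weight and an affine function near `x`, or near `x` with one fixed coordinate flipped if that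
parity is odd; words of equal parity keep their distance under this correction.

For parity queries, a linear combination of vectors in `𝔽₂ᵖ` can be rewritten with at most `p` of
them, so with `p ≤ k` queries the all-ones input is indistinguishable from some input of weight at
most `k`.
-/

namespace XorComm

section HammingDistance

variable {ι : Type*} [Fintype ι]

theorem hammingDist_one_add_hammingNorm (x : ι → ZMod 2) :
    hammingDist x 1 + hammingNorm x = Fintype.card ι := by
  have ne_one_iff : ∀ z : ZMod 2, z ≠ 1 ↔ ¬z ≠ 0 := by decide
  simp only [hammingDist, hammingNorm, Pi.one_apply, ne_one_iff]
  rw [add_comm, Finset.card_filter_add_card_filter_not, Finset.card_univ]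

theorem natCast_hammingDist (x y : ι → ZMod 2) :
    (hammingDist x y : ZMod 2) = ∑ i, x i + ∑ i, y i := by
  have boole_ne : ∀ a b : ZMod 2, (if a ≠ b then 1 else 0) = a + b := by decide
  rw [hammingDist, ← Finset.sum_boole, ← Finset.sum_add_distrib]
  exact Finset.sum_congr rfl fun i _ => boole_ne (x i) (y i)

theorem hammingDist_add_right {β : ι → Type*} [∀ i, Add (β i)] [∀ i, IsRightCancelAdd (β i)]
    [∀ i, DecidableEq (β i)] (x y z : ∀ i, β i) :
    hammingDist (x + z) (y + z) = hammingDist x y :=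
  hammingDist_comp (fun i a => a + z i) fun i => add_left_injective (z i)

theorem hammingDist_add_card_le {κ α : Type*} [Fintype κ] [DecidableEq α] (e : κ ↪ ι)
    (x y : ι → α) :
    hammingDist x y + Fintype.card κ ≤ hammingDist (x ∘ e) (y ∘ e) + Fintype.card ι := by
  have agree_le : (Finset.univ.filter fun j => x (e j) = y (e j)).card ≤
      (Finset.univ.filter fun i => x i = y i).card :=
    Finset.card_le_card_of_injOn e (fun j hj => by simpa using hj) e.injective.injOn
  have card_ι := Finset.card_filter_add_card_filter_not (s := Finset.univ) fun i => x i = y i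
  have card_κ :=
    Finset.card_filter_add_card_filter_not (s := Finset.univ) fun j => x (e j) = y (e j)
  simp only [Finset.card_univ] at card_ι card_κ
  simp only [hammingDist, Function.comp_apply, ne_eq]
  lia

end HammingDistance

section Walsh

/-- The nontrivial additive character `z ↦ (-1) ^ z` of `𝔽₂`, with integer values. -/
def signChar : AddChar (ZMod 2) ℤ :=
  AddChar.zmodChar 2 (ζ := -1) (by norm_num)

theorem sum_signChar_add {ι : Type*} [Fintype ι] (x y : ι → ZMod 2) :
    ∑ i, signChar (x i + y i) = Fintype.card ι - 2 * hammingDist x y := by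
  have signChar_add : ∀ a b : ZMod 2, signChar (a + b) = 1 - 2 * if a ≠ b then 1 else 0 := by
    decide
  simp only [signChar_add, Finset.sum_sub_distrib, ← Finset.mul_sum, Finset.sum_boole, hammingDist,
    Finset.sum_const, Finset.card_univ, nsmul_eq_mul, mul_one]

variable {m : ℕ}

theorem sum_signChar_dotProduct (u : Cube m) :
    ∑ a : Cube m, signChar (a ⬝ᵥ u) = if u = 0 then 2 ^ m else 0 := by
  split_ifs with hu
  · simp [hu]
  · let ψ : AddChar (Cube m) ℤ :=
      signChar.compAddMonoidHom (AddMonoidHom.mk' (· ⬝ᵥ u) fun a b => add_dotProduct a b u)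
    obtain ⟨j, hj⟩ := Function.ne_iff.mp hu
    have hψ : ψ ≠ 0 := AddChar.ne_zero_iff.mpr ⟨Pi.single j 1, by
      have signChar_ne_one : ∀ z : ZMod 2, z ≠ 0 → signChar z ≠ 1 := by decide
      simpa [ψ] using signChar_ne_one _ hj⟩
    exact AddChar.sum_eq_zero_iff_ne_zero.mpr hψ

/-- The Walsh coefficient at `a` of the Boolean function `x` on `𝔽₂ᵐ`: the correlation of `(-1) ^ x`
with the character `v ↦ (-1) ^ ⟨a, v⟩`, not normalized. -/
def walsh (x : Cube m → ZMod 2) (a : Cube m) : ℤ :=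
  ∑ v, signChar (x v + a ⬝ᵥ v)

theorem sum_walsh_sq (x : Cube m → ZMod 2) :
    ∑ a, walsh x a ^ 2 = 2 ^ m * 2 ^ m := by
  have orthogonality (v w : Cube m) :
      ∑ a : Cube m, signChar (x v + a ⬝ᵥ v) * signChar (x w + a ⬝ᵥ w) =
        if v = w then 2 ^ m else 0 := by
    calc ∑ a : Cube m, signChar (x v + a ⬝ᵥ v) * signChar (x w + a ⬝ᵥ w)
        = signChar (x v + x w) * ∑ a : Cube m, signChar (a ⬝ᵥ (v + w)) := by
          rw [Finset.mul_sum]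
          refine Finset.sum_congr rfl fun a _ => ?_
          simp only [dotProduct_add, AddChar.map_add_eq_mul]
          ring
      _ = if v = w then 2 ^ m else 0 := by
          have add_eq_zero : v + w = 0 ↔ v = w := by
            simp only [funext_iff, Pi.add_apply, Pi.zero_apply, CharTwo.add_eq_zero]
          simp only [sum_signChar_dotProduct, add_eq_zero]
          split_ifs with hvw
          · rw [hvw, CharTwo.add_self_eq_zero, AddChar.map_zero_eq_one, one_mul]
          · rw [mul_zero]
  calc ∑ a, walsh x a ^ 2
      = ∑ v, ∑ w, ∑ a : Cube m, signChar (x v + a ⬝ᵥ v) * signChar (x w + a ⬝ᵥ w) := by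
        simp only [walsh, sq, Finset.sum_mul_sum]
        rw [Finset.sum_comm]
        exact Finset.sum_congr rfl fun v _ => Finset.sum_comm
    _ = 2 ^ m * 2 ^ m := by
        simp [orthogonality]

theorem exists_two_pow_le_walsh_sq (x : Cube m → ZMod 2) : ∃ a, 2 ^ m ≤ walsh x a ^ 2 := by
  obtain ⟨a, -, ha⟩ : ∃ a ∈ Finset.univ, (2 : ℤ) ^ m ≤ walsh x a ^ 2 :=
    Finset.exists_le_of_sum_le Finset.univ_nonempty (by simp [sum_walsh_sq])
  exact ⟨a, ha⟩

end Walsh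

section ReedMuller

variable {m r : ℕ}

/-- The affine function `v ↦ ⟨a, v⟩ + b` on `𝔽₂ᵐ`. As words of length `2 ^ m`, these are the
codewords of the first-order Reed–Muller code. -/
def affineWord (a : Cube m) (b : ZMod 2) : Cube m → ZMod 2 :=
  fun v => a ⬝ᵥ v + b

theorem two_pow_sub_two_mul_hammingDist_affineWord (x : Cube m → ZMod 2) (a : Cube m)
    (b : ZMod 2) :
    2 ^ m - 2 * (hammingDist x (affineWord a b) : ℤ) = signChar b * walsh x a := by
  have h := sum_signChar_add x (affineWord a b)
  simp only [affineWord, ← add_assoc, AddChar.map_add_eq_mul _ _ b, ← Finset.sum_mul] at h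
  rw [mul_comm (signChar b), walsh, h, Fintype.card_fun, ZMod.card, Fintype.card_fin]
  norm_cast

theorem sum_cube_eq_zero (hm : 2 ≤ m) : ∑ v : Cube m, v = 0 := by
  ext i
  have : Nontrivial (Fin m) := Fin.nontrivial_iff_two_le.mpr hm
  obtain ⟨j, hji⟩ := exists_ne i
  rw [Finset.sum_apply]
  refine Finset.sum_involution (fun v _ => v + Pi.single j 1) ?_ ?_ ?_ ?_
  · intro v _
    simp [hji.symm, CharTwo.add_self_eq_zero]
  · intro v _ _ h
    simpa using congrFun h j
  · simp
  · intro v _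
    rw [add_assoc, CharTwo.add_self_eq_zero, add_zero]

theorem four_dvd_walsh (hm : 2 ≤ m) {x : Cube m → ZMod 2} (hx : ∑ v, x v = 0) (a : Cube m) :
    4 ∣ walsh x a := by
  have even_dist : Even (hammingDist x (affineWord a 0)) := by
    rw [← ZMod.natCast_eq_zero_iff_even, natCast_hammingDist, hx, zero_add]
    simp only [affineWord, add_zero]
    rw [← dotProduct_sum, sum_cube_eq_zero hm, dotProduct_zero]
  have h := two_pow_sub_two_mul_hammingDist_affineWord x a 0
  rw [AddChar.map_zero_eq_one, one_mul] at h
  rw [← h]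
  obtain ⟨d, hd⟩ := even_dist
  refine dvd_sub (pow_dvd_pow 2 hm) ⟨d, ?_⟩
  rw [hd]
  push_cast
  ring

theorem exists_hammingDist_affineWord_le (hm : 2 ≤ m) (hr : 4 ∣ r) (hrm : r ^ 2 < 2 ^ m)
    {x : Cube m → ZMod 2} (hx : ∑ v, x v = 0) :
    ∃ a b, 2 * hammingDist x (affineWord a b) + (r + 4) ≤ 2 ^ m := by
  obtain ⟨a, ha⟩ := exists_two_pow_le_walsh_sq x
  have lt_abs : (r : ℤ) < |walsh x a| := by
    rw [← abs_of_nonneg (Int.natCast_nonneg r), ← sq_lt_sq]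
    exact lt_of_lt_of_le (mod_cast hrm) ha
  have add_four_le : (r : ℤ) + 4 ≤ |walsh x a| := by
    have := (dvd_abs _ _).mpr (four_dvd_walsh hm hx a)
    lia
  obtain ⟨b, hb⟩ : ∃ b, signChar b * walsh x a = |walsh x a| := by
    rcases abs_choice (walsh x a) with h | h
    · exact ⟨0, by rw [h, AddChar.map_zero_eq_one, one_mul]⟩
    · exact ⟨1, by rw [h, show signChar 1 = -1 from rfl, neg_one_mul]⟩
  have h := two_pow_sub_two_mul_hammingDist_affineWord x a b
  refine ⟨a, b, ?_⟩
  zify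
  linarith

theorem exists_coloring_hammingDist_le (hm : 2 ≤ m) (hr : 4 ∣ r) (hrm : r ^ 2 < 2 ^ m) :
    ∃ c : (Cube m → ZMod 2) → Cube (m + 2),
      ∀ x y, c x = c y → hammingDist x y + (r + 4) ≤ 2 ^ m := by
  let evened (x : Cube m → ZMod 2) : Cube m → ZMod 2 := x + Pi.single 0 (∑ v, x v)
  have sum_evened (x) : ∑ v, evened x v = 0 := by
    simp [evened, Finset.sum_add_distrib, CharTwo.add_self_eq_zero]
  choose a b near using fun x => exists_hammingDist_affineWord_le hm hr hrm (sum_evened x)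
  refine ⟨fun x => Fin.cons (∑ v, x v) (Fin.cons (b x) (a x)), fun x y hxy => ?_⟩
  obtain ⟨parity_eq, hxy⟩ := Fin.cons_inj.mp hxy
  obtain ⟨b_eq, a_eq⟩ := Fin.cons_inj.mp hxy
  have dist_evened : hammingDist (evened x) (evened y) = hammingDist x y := by
    simp only [evened, parity_eq, hammingDist_add_right]
  have near_x := near x
  rw [a_eq, b_eq] at near_x
  have := hammingDist_triangle_right (evened x) (evened y) (affineWord (a y) (b y))
  have := near y
  lia

end ReedMuller

section ThresholdFun

variable {n k : ℕ} {x y : Cube n}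

theorem thresholdFun_eq_zero_iff : thresholdFun n k x = some 0 ↔ hammingNorm x ≤ k := by
  simp [thresholdFun]

theorem eq_one_of_thresholdFun_eq_one (hx : thresholdFun n k x = some 1) : x = 1 := by
  have norm_eq : hammingNorm x = n := by
    unfold thresholdFun at hx
    split_ifs at hx with h₁ h₂
    · simp at hx
    · exact h₂
  have := hammingDist_one_add_hammingNorm x
  rw [norm_eq, Fintype.card_fin] at this
  exact hammingDist_eq_zero.mp (by lia)

theorem thresholdFun_one (hk : k < n) : thresholdFun n k 1 = some 1 := by
  have norm_one : hammingNorm (1 : Cube n) = n := by simp [hammingNorm]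
  simp [thresholdFun, norm_one, hk]

theorem le_hammingDist_add_of_thresholdFun (hx : thresholdFun n k x = some 0)
    (hy : thresholdFun n k y = some 1) : n ≤ hammingDist x y + k := by
  rw [eq_one_of_thresholdFun_eq_one hy]
  have := hammingDist_one_add_hammingNorm x
  rw [Fintype.card_fin] at this
  have := thresholdFun_eq_zero_iff.mp hx
  lia

end ThresholdFun

section OneWay

variable {n t k : ℕ}

theorem oneWayCC_le_of_forall_eq {F : Cube n → Cube n → Option (ZMod 2)} (h : Cube n → Cube t)
    (hF : ∀ x x' y b b', h x = h x' → F x y = some b → F x' y = some b' → b = b') :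
    oneWayCC F ≤ t := by
  classical
  let φ (z : Cube t) (y : Cube n) : ZMod 2 :=
    if H : ∃ b x, h x = z ∧ F x y = some b then H.choose else 0
  refine Nat.sInf_le ⟨h, φ, fun x y b hb => ?_⟩
  have H : ∃ b' x', h x' = h x ∧ F x' y = some b' := ⟨b, x, rfl, hb⟩
  obtain ⟨x', hx', hb'⟩ := H.choose_spec
  exact (dif_pos H).trans (hF x' x y _ b hx' hb' hb)

theorem oneWayCC_thresholdFun_le_of_coloring {c : Cube n → Cube t}
    (hc : ∀ x z, c x = c z → hammingDist x z + k < n) :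
    oneWayCC (xorFun (thresholdFun n k)) ≤ t := by
  have separated (x z y : Cube n) (hxz : c x = c z) (hx : thresholdFun n k (x + y) = some 0) :
      thresholdFun n k (z + y) ≠ some 1 := fun hz => by
    have := le_hammingDist_add_of_thresholdFun hx hz
    rw [hammingDist_add_right] at this
    have := hc x z hxz
    lia
  refine oneWayCC_le_of_forall_eq c fun x z y b b' hxz hb hb' => ?_
  by_contra hne
  have zero_one_of_ne : ∀ b b' : ZMod 2, b ≠ b' → b = 0 ∧ b' = 1 ∨ b = 1 ∧ b' = 0 := by decide
  obtain ⟨rfl, rfl⟩ | ⟨rfl, rfl⟩ := zero_one_of_ne b b' hne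
  · exact separated x z y hxz hb hb'
  · exact separated z x y hxz.symm hb' hb

theorem oneWayCC_thresholdFun_le {m : ℕ} (hm : 2 ≤ m) (hn : 2 ^ m ≤ n)
    (hk : (4 * (k / 4)) ^ 2 < 2 ^ m) : oneWayCC (xorFun (thresholdFun n k)) ≤ m + 2 := by
  have card_cube : Fintype.card (Cube m) = 2 ^ m := by simp
  obtain ⟨e⟩ : Nonempty (Cube m ↪ Fin n) :=
    Function.Embedding.nonempty_of_card_le (by rwa [card_cube, Fintype.card_fin])
  obtain ⟨c, hc⟩ := exists_coloring_hammingDist_le hm (Dvd.intro _ rfl) hk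
  refine oneWayCC_thresholdFun_le_of_coloring (c := fun x => c (x ∘ e)) fun x z hxz => ?_
  have restrict := hammingDist_add_card_le e x z
  rw [card_cube, Fintype.card_fin] at restrict
  have := hc _ _ hxz
  lia

end OneWay

section ParityQueries

theorem exists_hammingNorm_le_finrank_sum_smul_eq {K V ι : Type*} [DivisionRing K] [DecidableEq K]
    [AddCommGroup V] [Module K V] [FiniteDimensional K V] [Fintype ι] {v : ι → V} {w : V}
    (hw : w ∈ Submodule.span K (Set.range v)) :
    ∃ c : ι → K, hammingNorm c ≤ Module.finrank K V ∧ ∑ i, c i • v i = w := by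
  obtain ⟨s, -, -, hspan, hli⟩ :=
    exists_linearIndepOn_extension (linearIndepOn_empty K v) (Set.empty_subset Set.univ)
  rw [Set.image_univ] at hspan
  obtain ⟨c, hcs, rfl⟩ := (Finsupp.mem_span_image_iff_linearCombination K).mp
    (Submodule.span_le.mpr hspan hw)
  refine ⟨c, ?_, (Finsupp.linearCombination_apply_of_mem_supported K (by simp)).symm⟩
  calc hammingNorm c = c.support.card := congrArg Finset.card (by ext i; simp)
    _ = Fintype.card c.support := (Fintype.card_coe _).symm
    _ ≤ Module.finrank K V := (hli.mono hcs).fintype_card_le_finrank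

variable {n k p : ℕ}

theorem lt_of_parityComputes_thresholdFun (hk : k < n) {s : Fin p → Cube n} {l : Cube p → ZMod 2}
    (h : ParityComputes s l (thresholdFun n k)) : k < p := by
  by_contra! hp
  let col (j : Fin n) : Cube p := fun i => s i j
  have sum_col (x : Cube n) : ∑ j, x j • col j = fun i => s i ⬝ᵥ x := by
    ext i
    simp [col, dotProduct, mul_comm]
  obtain ⟨x, hx, same_answers⟩ := exists_hammingNorm_le_finrank_sum_smul_eq (K := ZMod 2)
    (v := col) (w := ∑ j, (1 : Cube n) j • col j)
    (Submodule.sum_smul_mem _ _ fun j _ => Submodule.subset_span ⟨j, rfl⟩)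
  rw [Module.finrank_fin_fun] at hx
  simp only [sum_col] at same_answers
  have answer_x := h x 0 (thresholdFun_eq_zero_iff.mpr (hx.trans hp))
  rw [same_answers, h 1 1 (thresholdFun_one hk)] at answer_x
  exact one_ne_zero answer_x

theorem parityComputes_thresholdFun_of_lt (hk : k < n) :
    ParityComputes (fun i : Fin (k + 1) => Pi.single (Fin.castLE hk i) 1)
      (fun z => if z = 1 then 1 else 0) (thresholdFun n k) := by
  intro x b hb
  simp only [single_dotProduct, one_mul]
  have eq_zero_or_one : ∀ b : ZMod 2, b = 0 ∨ b = 1 := by decide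
  obtain rfl | rfl := eq_zero_or_one b
  · refine if_neg fun queried_eq_one => ?_
    have restrict := hammingDist_add_card_le (Fin.castLEEmb hk) x 1
    have restrict_eq :
        hammingDist (x ∘ Fin.castLEEmb hk) ((1 : Cube n) ∘ Fin.castLEEmb hk) = 0 :=
      hammingDist_eq_zero.mpr queried_eq_one
    have complement := hammingDist_one_add_hammingNorm x
    have := thresholdFun_eq_zero_iff.mp hb
    simp only [Fintype.card_fin] at restrict complement
    lia
  · rw [eq_one_of_thresholdFun_eq_one hb]
    exact if_pos rfl

theorem nadt_thresholdFun (hk : k < n) : nadt (thresholdFun n k) = k + 1 := by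
  refine le_antisymm (Nat.sInf_le ⟨_, _, parityComputes_thresholdFun_of_lt hk⟩) ?_
  refine le_csInf (exists_parity _) ?_
  rintro p ⟨s, l, h⟩
  exact lt_of_parityComputes_thresholdFun hk h

end ParityQueries

end XorComm

theorem mainTheorem10_general {m n k : ℕ} (hm : 2 ≤ m) (hn : 2 ^ m ≤ n)
    (hk : (4 * (k / 4)) ^ 2 < 2 ^ m) :
    XorComm.oneWayCC (XorComm.xorFun (XorComm.thresholdFun n k)) ≤ m + 2 ∧
      XorComm.nadt (XorComm.thresholdFun n k) = k + 1 := by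
  have rounded_lt : 4 * (k / 4) < 2 ^ m := lt_of_le_of_lt (Nat.le_self_pow two_ne_zero _) hk
  have four_dvd : 4 ∣ 2 ^ m := pow_dvd_pow 2 hm
  exact ⟨XorComm.oneWayCC_thresholdFun_le hm hn hk, XorComm.nadt_thresholdFun (by lia)⟩

theorem mainTheorem10 (n : ℕ) (hn : 32 ≤ n) :
    XorComm.oneWayCC (XorComm.xorFun (XorComm.thresholdFun n 7)) ≤ 7 ∧
      XorComm.nadt (XorComm.thresholdFun n 7) = 8 :=
  mainTheorem10_general (m := 5) (by norm_num) hn (by norm_num)
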